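/- Fix a number $H\ge 0$ of HVAC units, where unit $\ell$ consumes $P_\ell\in\mathbb R$ when it is ON, a number $m\ge 1$ of PV panels, and $N\ge1$ samples $\xi^1,\dots,\xi^N\in\mathbb R^m$ of the PV generation with total outputs $P_{\mathrm{total}}^n=\sum_{i=1}^m \xi^n_i$, sorted as $P_{\mathrm{total}}^{(1)}\ge\cdots\ge P_{\mathrm{total}}^{(N)}$. Let $\alpha\in(0,1)$, $\delta>0$ and $k=\lfloor\alpha N\rfloor$. Let $\|\cdot\|$ be a norm on $\mathbb R^m$, write $\|\mathbf 1\|_*=\sup\{\sum_i x_i:\|x\|\le1\}$ for the dual norm of the all-ones vector, and let $W(\mathbb P_1,\mathbb P_2)=\inf_{\mathbb Q}\int\|x-y\|\,\mathbb Q(dx,dy)$, over all joint distributions $\mathbb Q$ with marginals $\mathbb P_1,\mathbb P_2$, be the Wasserstein distance. Let $\mathcal D$ be the set of all probability distributions $f$ on $\mathbb R^m$ with $W(f,\frac1N\sum_{n=1}^N\delta_{\xi^n})\le\delta$, where $\delta_{\xi^n}$ is the point mass at $\xi^n$. Assume that all units ON give more load than the smallest total sample: $\sum_{\ell}P_\ell>P_{\mathrm{total}}^{(N)}$.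 Let $M_n, M_n^2$ ($n=1,\dots,k+1$) be sufficiently large constants, that is, $M_n\ge \sum_\ell P_\ell v_\ell-P_{\mathrm{total}}^{(n)}$ and $M_n^2\ge P_{\mathrm{total}}^{(n)}-\sum_\ell P_\ell v_\ell$ for all $v\in\{0,1\}^{H}$. Then for every $u\in\{0,1\}^{H}$ the distributionally robust chance constraint $$\inf_{f\in\mathcal D}\ \mathbb P_f\Big(\sum_{\ell}P_\ell u_\ell-\sum_{i=1}^m \widetilde P_{i}\ge0\Big)\ \ge\ 1-\alpha ,$$ where $\widetilde P\in\mathbb R^m$ denotes the random PV generation with distribution $f$, holds if and only if there are $a_1,\dots,a_{k+1}$ and $h_1,\dots,h_{k+1}$ with $$\frac1N\sum_{n=1}^{k}a_n+\Big(\alpha-\frac kN\Big)a_{k+1}\ \ge\ \delta\,\|\mathbf 1\|_*,$$ $$a_n\le\sum_\ell P_\ell u_\ell-P_{\mathrm{total}}^{(n)}+M_n^2(1-h_n),\qquad a_n\le M_nh_n,\qquad h_n\in\{0,1\},\ a_n\ge0\qquad(n=1,\dots,k+1).$$ In particular, if $\|\mathbf 1\|_*=1$ (for instance for the $\ell_1$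 norm, or for a single panel with the absolute value), the right-hand side of the first inequality is $\delta$. -/

import Mathlib

open MeasureTheory
open scoped ENNReal

noncomputable section

/-- The Wasserstein distance (of order one) between two measures on `ℝ^m`, for the transport cost
`‖x - y‖` given by the norm `nrm`: the infimum of the expected cost over all joint distributions
with the two given marginals. It is `[0, ∞]`-valued. -/
def wassersteinDist {m : ℕ} (nrm : Seminorm ℝ (Fin m → ℝ)) (μ ν : Measure (Fin m → ℝ)) : ℝ≥0∞ :=
  ⨅ (Q : Measure ((Fin m → ℝ) × (Fin m → ℝ))) (_ : Q.fst = μ ∧ Q.snd = ν),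
    ∫⁻ z, ENNReal.ofReal (nrm (z.1 - z.2)) ∂Q

/-- The empirical distribution of `N` samples: each sample has probability `1 / N`. -/
def empiricalDist {m N : ℕ} (ξ : Fin N → Fin m → ℝ) : Measure (Fin m → ℝ) :=
  ∑ n, (N : ℝ≥0∞)⁻¹ • Measure.dirac (ξ n)

/-- The Wasserstein ambiguity set: all probability distributions on `ℝ^m` at distance at most `δ`
from the empirical distribution of the samples. -/
def wassersteinBall {m N : ℕ} (nrm : Seminorm ℝ (Fin m → ℝ)) (ξ : Fin N → Fin m → ℝ) (δ : ℝ) :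
    Set (Measure (Fin m → ℝ)) :=
  {f | IsProbabilityMeasure f ∧ wassersteinDist nrm f (empiricalDist ξ) ≤ ENNReal.ofReal δ}

/-- The total load `∑ P_ℓ u_ℓ` of the HVAC fleet under the ON/OFF decisions `u`. -/
def load {H : ℕ} (P u : Fin H → ℝ) : ℝ := ∑ l, P l * u l

/-- The total PV output of all panels. -/
def totalPV {m : ℕ} (x : Fin m → ℝ) : ℝ := ∑ i, x i

/-- Vectors of ON/OFF decisions. -/
def IsBinary {H : ℕ} (u : Fin H → ℝ) : Prop := ∀ l, u l = 0 ∨ u l = 1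

/-- The distributionally robust chance constraint
`inf_{f ∈ D} P_f (L - total PV ≥ 0) ≥ 1 - α` for the load `L`. -/
def DRChanceConstraint {m : ℕ} (D : Set (Measure (Fin m → ℝ))) (L α : ℝ) : Prop :=
  ENNReal.ofReal (1 - α) ≤ ⨅ f ∈ D, f {x | L - totalPV x ≥ 0}

/-- The dual norm of the all-ones vector, `sup {∑ x_i : ‖x‖ ≤ 1}`. -/
def dualNormOnes {m : ℕ} (nrm : Seminorm ℝ (Fin m → ℝ)) : ℝ :=
  sSup (totalPV '' {x | nrm x ≤ 1})

/-- The number `k = ⌊α N⌋`. -/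
def riskIndex (α : ℝ) (N : ℕ) : ℕ := ⌊α * N⌋₊

theorem riskIndex_succ_le {α : ℝ} {N : ℕ} (hα : α < 1) (hN : 0 < N) : riskIndex α N + 1 ≤ N := by
  have hN' : (0 : ℝ) < N := by exact_mod_cast hN
  exact (Nat.floor_lt' hN.ne').2 (by nlinarith)

/-- Feasibility, for the load `L`, of the mixed-integer linear system in the auxiliary variables
`a_1, …, a_{k+1} ≥ 0` and `h_1, …, h_{k+1} ∈ {0, 1}`, with big-M constants `M` and `M2`. The entry
`Q j` is the sorted total PV sample `P^{(j+1)}`, and `r` is the right-hand side of the first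
constraint. Indices start at `0`, so `Fin.last k` stands for the index `k + 1`. -/
def MILPFeasible {N k : ℕ} (hk : k + 1 ≤ N) (α r L : ℝ) (Q : Fin N → ℝ)
    (M M2 : Fin (k + 1) → ℝ) : Prop :=
  ∃ a h : Fin (k + 1) → ℝ,
    (1 / (N : ℝ)) * ∑ n : Fin k, a n.castSucc + (α - (k : ℝ) / N) * a (Fin.last k) ≥ r ∧
    (∀ n, a n ≤ L - Q (Fin.castLE hk n) + M2 n * (1 - h n)) ∧
    (∀ n, a n ≤ M n * h n) ∧
    (∀ n, (h n = 0 ∨ h n = 1) ∧ a n ≥ 0)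

end

/-!
Write `c = dualNormOnes nrm` for the dual norm of the all-ones vector, `L` for the load and
`Q_1 ≥ ⋯ ≥ Q_N` for the sorted total outputs of the samples. The constraint fails exactly when some
distribution in the Wasserstein ball gives mass more than `α` to `{x | L < totalPV x}`. Lifting a
sample `ξ` to this open half space costs `(L - totalPV ξ)⁺ / c` per unit of mass (an infimum), so
the cheapest way to bring mass `α` there empties the samples with the largest output first, at total
cost `greedyCost / c`. Hence the constraint says `δ * c ≤ greedyCost`.

* If `δ * c ≤ greedyCost`, let `t = (L - Q_{k+1})⁺`. For all `x` and `y` the bound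
  `t * 1[L < totalPV x] ≤ c * nrm (x - y) + (t - (L - totalPV y)⁺)⁺` holds; integrating it against a
  coupling (`mul_measure_le_wassersteinDist`) bounds the mass above `L`, because
  `greedyCost = t * α - (1/N) ∑ (t - (L - Q_n)⁺)⁺` (`greedyCost_eq_mul_sub`) and `t > 0`.
* If `greedyCost < δ * c`, there is room to move slightly more than `α` slightly beyond the level
  `L`, in a direction that nearly attains the dual norm
  (`exists_isProbabilityMeasure_of_moves`, `le_greedyCost_of_drChanceConstraint`).

The mixed-integer system only encodes `0 ≤ a_n ≤ (L - Q_n)⁺`, so it is feasible if and only if its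
right-hand side is at most `greedyCost` (`milpFeasible_iff_le_greedyCost`).
-/

/-! ### The dual norm of the all-ones vector -/

/-- Linear functionals on a finite-dimensional space are bounded with respect to every norm. -/
theorem LinearMap.exists_le_mul_seminorm {V : Type*} [AddCommGroup V] [Module ℝ V]
    [FiniteDimensional ℝ V] (p : Seminorm ℝ V) (hp : ∀ x, p x = 0 → x = 0) (φ : V →ₗ[ℝ] ℝ) :
    ∃ C : ℝ, ∀ x, φ x ≤ C * p x := by
  let : NormedAddCommGroup V := AddGroupNorm.toNormedAddCommGroup
    { p.toAddGroupSeminorm with eq_zero_of_map_eq_zero' := hp }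
  let : NormedSpace ℝ V := ⟨fun a b => (map_smul_eq_mul p a b).le⟩
  exact ⟨‖LinearMap.toContinuousLinearMap φ‖, fun x =>
    (le_abs_self _).trans ((LinearMap.toContinuousLinearMap φ).le_opNorm x)⟩

theorem totalPV_add {m : ℕ} (x y : Fin m → ℝ) : totalPV (x + y) = totalPV x + totalPV y := by
  simp [totalPV, Finset.sum_add_distrib]

theorem totalPV_sub {m : ℕ} (x y : Fin m → ℝ) : totalPV (x - y) = totalPV x - totalPV y := by
  simp [totalPV, Finset.sum_sub_distrib]

theorem totalPV_smul {m : ℕ} (c : ℝ) (x : Fin m → ℝ) : totalPV (c • x) = c * totalPV x := by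
  simp [totalPV, Finset.mul_sum]

theorem measurable_totalPV {m : ℕ} : Measurable (totalPV : (Fin m → ℝ) → ℝ) := by
  unfold totalPV
  fun_prop

theorem bddAbove_totalPV_unitBall {m : ℕ} (nrm : Seminorm ℝ (Fin m → ℝ))
    (hnrm : ∀ x, nrm x = 0 → x = 0) : BddAbove (totalPV '' {x | nrm x ≤ 1}) := by
  obtain ⟨C, hC⟩ := LinearMap.exists_le_mul_seminorm nrm hnrm
    { toFun := totalPV, map_add' := totalPV_add, map_smul' := totalPV_smul }
  refine ⟨|C|, ?_⟩
  rintro _ ⟨x, hx, rfl⟩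
  calc totalPV x ≤ C * nrm x := hC x
    _ ≤ |C| * nrm x := mul_le_mul_of_nonneg_right (le_abs_self C) (apply_nonneg nrm x)
    _ ≤ |C| * 1 := mul_le_mul_of_nonneg_left hx (abs_nonneg C)
    _ = |C| := mul_one _

theorem totalPV_le_dualNormOnes_mul {m : ℕ} (nrm : Seminorm ℝ (Fin m → ℝ))
    (hnrm : ∀ x, nrm x = 0 → x = 0) (x : Fin m → ℝ) :
    totalPV x ≤ dualNormOnes nrm * nrm x := by
  by_cases h : nrm x = 0
  · simp [hnrm x h, totalPV]
  have hpos : 0 < nrm x := lt_of_le_of_ne (apply_nonneg nrm x) (Ne.symm h)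
  have hunit : nrm ((nrm x)⁻¹ • x) ≤ 1 := by
    rw [map_smul_eq_mul, norm_inv, Real.norm_of_nonneg hpos.le, inv_mul_cancel₀ h]
  have hle := le_csSup (bddAbove_totalPV_unitBall nrm hnrm) ⟨_, hunit, rfl⟩
  rw [totalPV_smul, inv_mul_le_iff₀ hpos, mul_comm] at hle
  exact hle

theorem dualNormOnes_pos {m : ℕ} (hm : 0 < m) (nrm : Seminorm ℝ (Fin m → ℝ))
    (hnrm : ∀ x, nrm x = 0 → x = 0) : 0 < dualNormOnes nrm := by
  have h := totalPV_le_dualNormOnes_mul nrm hnrm 1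
  have h1 : totalPV (1 : Fin m → ℝ) = m := by simp [totalPV]
  rw [h1] at h
  have hm' : (0 : ℝ) < m := by exact_mod_cast hm
  exact pos_of_mul_pos_left (hm'.trans_le h) (apply_nonneg nrm 1)

theorem exists_lt_totalPV {m : ℕ} (nrm : Seminorm ℝ (Fin m → ℝ)) {s : ℝ}
    (hs : s < dualNormOnes nrm) : ∃ v, nrm v ≤ 1 ∧ s < totalPV v := by
  obtain ⟨_, ⟨v, hv, rfl⟩, hsv⟩ :=
    exists_lt_of_lt_csSup (Set.Nonempty.image _ ⟨0, by simp⟩) hs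
  exact ⟨v, hv, hsv⟩

/-! ### The greedy transport cost and the mixed-integer system -/

/-- The sum `(1/N) ∑_{n ≤ k} (L - Q_n)⁺ + (α - k/N) (L - Q_{k+1})⁺`. For samples `Q` in
non-increasing order and `k = ⌊αN⌋` it is the least cost, in units of total output, of lifting
mass `α` of the samples up to the level `L`. -/
noncomputable def greedyCost {N k : ℕ} (hk : k + 1 ≤ N) (α L : ℝ) (Q : Fin N → ℝ) : ℝ :=
  (1 / (N : ℝ)) * ∑ n : Fin k, max (L - Q (Fin.castLE hk n.castSucc)) 0 +
    (α - (k : ℝ) / N) * max (L - Q (Fin.castLE hk (Fin.last k))) 0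

/-- The big-M constraints on `a n` and `h n` say that `0 ≤ a n ≤ (L - Q n)⁺`. -/
theorem milpFeasible_iff_le_greedyCost {N k : ℕ} (hk : k + 1 ≤ N) {α r L : ℝ} {Q : Fin N → ℝ}
    {M M2 : Fin (k + 1) → ℝ} (hkα : (k : ℝ) / N ≤ α)
    (hM : ∀ n, L - Q (Fin.castLE hk n) ≤ M n) (hM2 : ∀ n, Q (Fin.castLE hk n) - L ≤ M2 n) :
    MILPFeasible hk α r L Q M M2 ↔ r ≤ greedyCost hk α L Q := by
  constructor
  · rintro ⟨a, h, hr, h1, h2, h3⟩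
    have ha : ∀ n, a n ≤ max (L - Q (Fin.castLE hk n)) 0 := by
      intro n
      rcases (h3 n).1 with h0 | h0
      · have := h2 n
        rw [h0, mul_zero] at this
        exact this.trans (le_max_right _ _)
      · have := h1 n
        rw [h0, sub_self, mul_zero, add_zero] at this
        exact this.trans (le_max_left _ _)
    refine hr.le.trans (add_le_add ?_ ?_)
    · exact mul_le_mul_of_nonneg_left (Finset.sum_le_sum fun n _ => ha _) (by positivity)
    · exact mul_le_mul_of_nonneg_left (ha _) (sub_nonneg.2 hkα)
  · intro hr
    refine ⟨fun n => max (L - Q (Fin.castLE hk n)) 0,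
      fun n => if 0 ≤ L - Q (Fin.castLE hk n) then 1 else 0, hr, fun n => ?_, fun n => ?_,
      fun n => ⟨?_, le_max_right _ _⟩⟩
    · have := hM2 n
      by_cases h : 0 ≤ L - Q (Fin.castLE hk n)
      · simp [h]
      · simp only [h, if_false, max_eq_right (not_le.1 h).le]
        linarith
    · have := hM n
      by_cases h : 0 ≤ L - Q (Fin.castLE hk n)
      · simp [h, this]
      · simp [h, max_eq_right (not_le.1 h).le]
    · by_cases h : 0 ≤ L - Q (Fin.castLE hk n) <;> simp [h]

theorem sum_fin_eq_sum_castLE {N k : ℕ} (hk : k + 1 ≤ N) (F : Fin N → ℝ)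
    (hF : ∀ n : Fin N, k < n → F n = 0) :
    ∑ n, F n = ∑ n : Fin k, F (Fin.castLE hk n.castSucc) + F (Fin.castLE hk (Fin.last k)) := by
  obtain ⟨j, rfl⟩ := Nat.exists_eq_add_of_le hk
  rw [Fin.sum_univ_add, Finset.sum_eq_zero (s := Finset.univ (α := Fin j)), add_zero,
    Fin.sum_univ_castSucc]
  · rfl
  · intro i _
    exact hF _ (by simp; omega)

/-- The greedy cost in its dual form, with the multiplier `t = (L - Q_{k+1})⁺`. -/
theorem greedyCost_eq_mul_sub {N k : ℕ} (hk : k + 1 ≤ N) (α L : ℝ) {Q : Fin N → ℝ}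
    (hQ : Antitone Q) :
    greedyCost hk α L Q = max (L - Q (Fin.castLE hk (Fin.last k))) 0 * α -
      1 / N * ∑ n, max (max (L - Q (Fin.castLE hk (Fin.last k))) 0 - max (L - Q n) 0) 0 := by
  rw [sum_fin_eq_sum_castLE hk]
  · set t := max (L - Q (Fin.castLE hk (Fin.last k))) 0
    have h1 : ∀ n : Fin k, max (t - max (L - Q (Fin.castLE hk n.castSucc)) 0) 0 =
        t - max (L - Q (Fin.castLE hk n.castSucc)) 0 := by
      intro n
      have := hQ (show Fin.castLE hk n.castSucc ≤ Fin.castLE hk (Fin.last k) from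
        Fin.le_def.2 (by simp))
      exact max_eq_left (sub_nonneg.2 (max_le_max (by linarith) le_rfl))
    simp only [h1, sub_self, max_self, Finset.sum_sub_distrib, Finset.sum_const,
      Finset.card_univ, Fintype.card_fin, nsmul_eq_mul]
    unfold greedyCost
    ring
  · intro n hn
    have := hQ (show Fin.castLE hk (Fin.last k) ≤ n from Fin.le_def.2 (by simpa using hn.le))
    exact max_eq_right (sub_nonpos.2 (max_le_max (by linarith) le_rfl))

/-! ### Transport plans out of the empirical distribution -/

theorem lintegral_empiricalDist {m N : ℕ} (ξ : Fin N → Fin m → ℝ) (g : (Fin m → ℝ) → ℝ≥0∞) :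
    ∫⁻ y, g y ∂empiricalDist ξ = ∑ n, (N : ℝ≥0∞)⁻¹ * g (ξ n) := by
  simp [empiricalDist, lintegral_finsetSum_measure]

theorem empiricalDist_comp_perm {m N : ℕ} (ξ : Fin N → Fin m → ℝ) (σ : Equiv.Perm (Fin N)) :
    empiricalDist (fun n => ξ (σ n)) = empiricalDist ξ :=
  Equiv.sum_comp σ fun n => (N : ℝ≥0∞)⁻¹ • Measure.dirac (ξ n)

/-- Weak duality for the transport problem: a coupling of `f` with the empirical distribution moves
the part of `f` above the level `L` at a cost bounded below through any multiplier `t ≥ 0`. -/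
theorem mul_measure_le_wassersteinDist {m N : ℕ} (nrm : Seminorm ℝ (Fin m → ℝ)) {c : ℝ}
    (hc : 0 < c) (hle : ∀ x, totalPV x ≤ c * nrm x) (ξ : Fin N → Fin m → ℝ)
    (f : Measure (Fin m → ℝ)) (L t : ℝ) :
    ENNReal.ofReal t * f {x | L < totalPV x} ≤
      ENNReal.ofReal c * wassersteinDist nrm f (empiricalDist ξ) +
        ∑ n, (N : ℝ≥0∞)⁻¹ * ENNReal.ofReal (max (t - max (L - totalPV (ξ n)) 0) 0) := by
  have hS : MeasurableSet {x : Fin m → ℝ | L < totalPV x} :=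
    measurableSet_lt measurable_const measurable_totalPV
  have hg : Measurable fun y : Fin m → ℝ =>
      ENNReal.ofReal (max (t - max (L - totalPV y) 0) 0) := by
    have := measurable_totalPV (m := m)
    fun_prop
  have hg' : Measurable fun z : (Fin m → ℝ) × (Fin m → ℝ) =>
      ENNReal.ofReal (max (t - max (L - totalPV z.2) 0) 0) := hg.comp measurable_snd
  rw [← lintegral_empiricalDist ξ fun y => ENNReal.ofReal (max (t - max (L - totalPV y) 0) 0)]
  unfold wassersteinDist
  rw [ENNReal.mul_iInf_of_ne (by simpa using hc) ENNReal.ofReal_ne_top, ENNReal.iInf_add]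
  refine le_iInf fun Q => ?_
  rw [ENNReal.mul_iInf_of_ne (by simpa using hc) ENNReal.ofReal_ne_top, ENNReal.iInf_add]
  refine le_iInf fun ⟨hQ1, hQ2⟩ => ?_
  rw [← hQ1, ← hQ2, Measure.fst_apply hS, Measure.snd, lintegral_map hg measurable_snd,
    ← lintegral_const_mul' _ _ ENNReal.ofReal_ne_top, ← lintegral_add_right _ hg',
    ← lintegral_indicator_const (measurable_fst hS)]
  refine lintegral_mono fun z => ?_
  by_cases hz : L < totalPV z.1
  · rw [Set.indicator_of_mem (by exact hz), ← ENNReal.ofReal_mul hc.le,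
      ← ENNReal.ofReal_add (by positivity) (le_max_right _ _)]
    refine ENNReal.ofReal_le_ofReal ?_
    have h1 := hle (z.1 - z.2)
    rw [totalPV_sub] at h1
    have h2 : 0 ≤ c * nrm (z.1 - z.2) := by positivity
    have h3 : max (L - totalPV z.2) 0 ≤ c * nrm (z.1 - z.2) := max_le (by linarith) h2
    linarith [le_max_left (t - max (L - totalPV z.2) 0) 0]
  · rw [Set.indicator_of_notMem (by exact hz)]
    exact zero_le

/-- Moving mass `w n ≤ 1 / N` from the sample `ξ n` to the point `y n`, for every `n`. -/
theorem exists_isProbabilityMeasure_of_moves {m N : ℕ} (hN : 0 < N)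
    (nrm : Seminorm ℝ (Fin m → ℝ)) (ξ y : Fin N → Fin m → ℝ) (w : Fin N → ℝ)
    (hw0 : ∀ n, 0 ≤ w n) (hw1 : ∀ n, w n ≤ 1 / N) (S : Set (Fin m → ℝ))
    (hyS : ∀ n, y n ∈ S) :
    ∃ f : Measure (Fin m → ℝ), IsProbabilityMeasure f ∧
      wassersteinDist nrm f (empiricalDist ξ) ≤ ENNReal.ofReal (∑ n, w n * nrm (y n - ξ n)) ∧
      ENNReal.ofReal (∑ n, w n) ≤ f S := by
  have hN' : (0 : ℝ) < N := by exact_mod_cast hN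
  have hsplit : ∀ n, ENNReal.ofReal (1 / N - w n) + ENNReal.ofReal (w n) = (N : ℝ≥0∞)⁻¹ := by
    intro n
    rw [← ENNReal.ofReal_add (sub_nonneg.2 (hw1 n)) (hw0 n), sub_add_cancel, one_div,
      ENNReal.ofReal_inv_of_pos hN', ENNReal.ofReal_natCast]
  let Q : Measure ((Fin m → ℝ) × (Fin m → ℝ)) :=
    ∑ n, (ENNReal.ofReal (1 / N - w n) • Measure.dirac (ξ n, ξ n) +
      ENNReal.ofReal (w n) • Measure.dirac (y n, ξ n))
  have hfst : Q.fst = ∑ n, (ENNReal.ofReal (1 / N - w n) • Measure.dirac (ξ n) +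
      ENNReal.ofReal (w n) • Measure.dirac (y n)) := by
    simp only [Q, Measure.fst, Measure.map_finset_sum measurable_fst.aemeasurable,
      Measure.map_add _ _ measurable_fst, Measure.map_smul, Measure.map_dirac' measurable_fst]
  have hsnd : Q.snd = empiricalDist ξ := by
    simp only [Q, Measure.snd, Measure.map_finset_sum measurable_snd.aemeasurable,
      Measure.map_add _ _ measurable_snd, Measure.map_smul, Measure.map_dirac' measurable_snd,
      ← add_smul, hsplit, empiricalDist]
  refine ⟨Q.fst, ⟨?_⟩, ?_, ?_⟩
  · rw [hfst]
    simp only [Measure.finsetSum_apply, Measure.add_apply, Measure.smul_apply, measure_univ,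
      smul_eq_mul, mul_one, hsplit, Finset.sum_const, Finset.card_univ, Fintype.card_fin,
      nsmul_eq_mul]
    exact ENNReal.mul_inv_cancel (by exact_mod_cast hN.ne') (ENNReal.natCast_ne_top N)
  · refine (iInf₂_le Q ⟨rfl, hsnd⟩).trans (le_of_eq ?_)
    rw [ENNReal.ofReal_sum_of_nonneg fun n _ => mul_nonneg (hw0 n) (apply_nonneg nrm _)]
    simp [Q, lintegral_finsetSum_measure, ENNReal.ofReal_mul, hw0]
  · rw [hfst, ENNReal.ofReal_sum_of_nonneg fun n _ => hw0 n, Measure.finsetSum_apply]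
    refine Finset.sum_le_sum fun n _ => ?_
    have hd : Measure.dirac (y n) S = 1 := Measure.dirac_apply_of_mem (hyS n)
    simp [hd]

/-! ### The chance constraint over the Wasserstein ball -/

theorem drChanceConstraint_of_le_greedyCost {m N k : ℕ} (hk : k + 1 ≤ N)
    (nrm : Seminorm ℝ (Fin m → ℝ)) {c α δ L : ℝ} (hc : 0 < c)
    (hle : ∀ x, totalPV x ≤ c * nrm x) (ξ : Fin N → Fin m → ℝ)
    (hξ : Antitone fun n => totalPV (ξ n)) (hα0 : 0 ≤ α) (hδ : 0 < δ)
    (h : δ * c ≤ greedyCost hk α L fun n => totalPV (ξ n)) :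
    DRChanceConstraint (wassersteinBall nrm ξ δ) L α := by
  refine le_iInf₂ fun f ⟨hf, hW⟩ => ?_
  have hS : MeasurableSet {x : Fin m → ℝ | L < totalPV x} :=
    measurableSet_lt measurable_const measurable_totalPV
  have hcompl : {x : Fin m → ℝ | L - totalPV x ≥ 0} = {x | L < totalPV x}ᶜ := by
    ext x
    simp
  rw [hcompl, prob_compl_eq_one_sub hS, ENNReal.ofReal_sub _ hα0, ENNReal.ofReal_one]
  refine tsub_le_tsub_left ?_ 1
  have hdual := mul_measure_le_wassersteinDist nrm hc hle ξ f L
    (max (L - totalPV (ξ (Fin.castLE hk (Fin.last k)))) 0)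
  rw [greedyCost_eq_mul_sub hk α L hξ] at h
  -- The multiplier is positive because the radius is: a zero multiplier makes the cost zero.
  have ht : 0 < max (L - totalPV (ξ (Fin.castLE hk (Fin.last k)))) 0 := by
    refine (le_max_right _ _).lt_of_ne' fun h0 => ?_
    have hs : 0 ≤ 1 / (N : ℝ) * ∑ n, max (max (L - totalPV (ξ (Fin.castLE hk (Fin.last k)))) 0 -
      max (L - totalPV (ξ n)) 0) 0 :=
      mul_nonneg (by positivity) (Finset.sum_nonneg fun n _ => le_max_right _ _)
    have : 0 < δ * c := mul_pos hδ hc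
    rw [h0, zero_mul] at h
    rw [h0] at hs
    linarith
  set t := max (L - totalPV (ξ (Fin.castLE hk (Fin.last k)))) 0
  have hN' : (0 : ℝ) < N := by exact_mod_cast (Nat.succ_pos k).trans_le hk
  have hsum : ∑ n, (N : ℝ≥0∞)⁻¹ * ENNReal.ofReal (max (t - max (L - totalPV (ξ n)) 0) 0) =
      ENNReal.ofReal (1 / N * ∑ n, max (t - max (L - totalPV (ξ n)) 0) 0) := by
    rw [ENNReal.ofReal_mul (by positivity), one_div, ENNReal.ofReal_inv_of_pos hN',
      ENNReal.ofReal_natCast, ENNReal.ofReal_sum_of_nonneg fun n _ => le_max_right _ _,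
      Finset.mul_sum]
  have hs : 0 ≤ 1 / (N : ℝ) * ∑ n, max (t - max (L - totalPV (ξ n)) 0) 0 :=
    mul_nonneg (by positivity) (Finset.sum_nonneg fun n _ => le_max_right _ _)
  have key : ENNReal.ofReal t * f {x | L < totalPV x} ≤
      ENNReal.ofReal t * ENNReal.ofReal α := by
    calc ENNReal.ofReal t * f {x | L < totalPV x}
        ≤ ENNReal.ofReal c * ENNReal.ofReal δ +
          ENNReal.ofReal (1 / N * ∑ n, max (t - max (L - totalPV (ξ n)) 0) 0) := by
          rw [← hsum]
          exact hdual.trans (by gcongr)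
      _ = ENNReal.ofReal (c * δ + 1 / N * ∑ n, max (t - max (L - totalPV (ξ n)) 0) 0) := by
          rw [← ENNReal.ofReal_mul hc.le, ENNReal.ofReal_add (by positivity) hs]
      _ ≤ ENNReal.ofReal (t * α) := ENNReal.ofReal_le_ofReal (by linarith)
      _ = _ := ENNReal.ofReal_mul ht.le
  exact (ENNReal.mul_le_mul_iff_right (by simpa using ht) ENNReal.ofReal_ne_top).1 key

theorem le_greedyCost_of_drChanceConstraint {m N k : ℕ} (hk : k + 1 ≤ N)
    (nrm : Seminorm ℝ (Fin m → ℝ)) (hc : 0 < dualNormOnes nrm) {α δ L : ℝ}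
    (ξ : Fin N → Fin m → ℝ) (hα1 : α < 1) (hkα : (k : ℝ) / N ≤ α) (hαk : α < (k + 1 : ℝ) / N)
    (hδ : 0 < δ) (h : DRChanceConstraint (wassersteinBall nrm ξ δ) L α) :
    δ * dualNormOnes nrm ≤ greedyCost hk α L fun n => totalPV (ξ n) := by
  by_contra! hlt
  have hN : 0 < N := (Nat.succ_pos k).trans_le hk
  have hN' : (0 : ℝ) < N := by exact_mod_cast hN
  -- The direction `v` lifts the total output almost as efficiently as possible.
  obtain ⟨v, hv, hsv⟩ := exists_lt_totalPV nrm
    (s := max (greedyCost hk α L (fun n => totalPV (ξ n)) / δ) 0)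
    (max_lt ((div_lt_iff₀' hδ).2 hlt) hc)
  obtain ⟨hgs, hs⟩ := max_lt_iff.1 hsv
  rw [div_lt_iff₀' hδ] at hgs
  set s := totalPV v
  set G := greedyCost hk α L fun n => totalPV (ξ n) with hG
  set t := max (L - totalPV (ξ (Fin.castLE hk (Fin.last k)))) 0 with ht
  have ht0 : 0 ≤ t := le_max_right _ _
  -- The slack `ε` pays for the additional mass, at most `ε t`, and for overshooting, at most `ε`.
  obtain ⟨ε, hε, hε1, hε2, hε3⟩ : ∃ ε : ℝ, 0 < ε ∧ α + ε ≤ (k + 1 : ℝ) / N ∧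
      ε * (t + 1) ≤ δ * s - G ∧ α + ε ≤ 1 := by
    refine ⟨min (min ((k + 1 : ℝ) / N - α) ((δ * s - G) / (t + 1))) (1 - α), ?_, ?_, ?_, ?_⟩
    · refine lt_min (lt_min (sub_pos.2 hαk) (div_pos (sub_pos.2 hgs) (by positivity)))
        (sub_pos.2 hα1)
    · linarith [min_le_left (min ((k + 1 : ℝ) / N - α) ((δ * s - G) / (t + 1))) (1 - α),
        min_le_left ((k + 1 : ℝ) / N - α) ((δ * s - G) / (t + 1))]
    · rw [← le_div_iff₀ (by positivity)]
      exact (min_le_left _ _).trans (min_le_right _ _)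
    · linarith [min_le_right (min ((k + 1 : ℝ) / N - α) ((δ * s - G) / (t + 1))) (1 - α)]
  set w : Fin N → ℝ := fun n =>
    if (n : ℕ) < k then 1 / N else if (n : ℕ) = k then α - k / N + ε else 0 with hw
  have hw0 : ∀ n, 0 ≤ w n := by
    intro n
    simp only [hw]
    split_ifs <;> positivity
  have hw1 : ∀ n, w n ≤ 1 / N := by
    intro n
    simp only [hw]
    split_ifs
    · exact le_rfl
    · rw [add_div] at hε1
      linarith
    · positivity
  have hwsum : ∀ F : Fin N → ℝ, ∑ n, w n * F n =
      1 / N * ∑ n : Fin k, F (Fin.castLE hk n.castSucc) +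
        (α - k / N + ε) * F (Fin.castLE hk (Fin.last k)) := by
    intro F
    rw [sum_fin_eq_sum_castLE hk]
    · simp [hw, Finset.mul_sum]
    · intro n hn
      simp [hw, hn.not_gt, hn.ne']
  have hwmass : ∑ n, w n = α + ε := by
    have := hwsum fun _ => 1
    simp only [mul_one, Finset.sum_const, Finset.card_univ, Fintype.card_fin,
      nsmul_eq_mul] at this
    rw [this]
    ring
  have hwcost : ∑ n, w n * max (L - totalPV (ξ n)) 0 = G + ε * t := by
    rw [hwsum, hG, greedyCost, ht]
    ring
  obtain ⟨f, hf, hfW, hfS⟩ := exists_isProbabilityMeasure_of_moves hN nrm ξ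
    (fun n => ξ n + ((max (L - totalPV (ξ n)) 0 + ε) / s) • v) w hw0 hw1
    {x | L < totalPV x} (by
      intro n
      change L < totalPV (ξ n + ((max (L - totalPV (ξ n)) 0 + ε) / s) • v)
      rw [totalPV_add, totalPV_smul, div_mul_cancel₀ _ hs.ne']
      linarith [le_max_left (L - totalPV (ξ n)) 0])
  have hcost : ∑ n, w n * nrm (ξ n + ((max (L - totalPV (ξ n)) 0 + ε) / s) • v - ξ n) ≤ δ := by
    calc ∑ n, w n * nrm (ξ n + ((max (L - totalPV (ξ n)) 0 + ε) / s) • v - ξ n)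
        ≤ ∑ n, w n * ((max (L - totalPV (ξ n)) 0 + ε) / s) := by
          refine Finset.sum_le_sum fun n _ => mul_le_mul_of_nonneg_left ?_ (hw0 n)
          have h0 : 0 ≤ (max (L - totalPV (ξ n)) 0 + ε) / s :=
            div_nonneg (add_nonneg (le_max_right _ _) hε.le) hs.le
          rw [add_sub_cancel_left, map_smul_eq_mul, Real.norm_of_nonneg h0]
          exact mul_le_of_le_one_right h0 hv
      _ = (∑ n, w n * max (L - totalPV (ξ n)) 0 + (∑ n, w n) * ε) / s := by
          rw [Finset.sum_mul, ← Finset.sum_add_distrib, Finset.sum_div]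
          exact Finset.sum_congr rfl fun n _ => by ring
      _ ≤ δ := by
          rw [hwcost, hwmass, div_le_iff₀ hs]
          nlinarith
  have hball : f ∈ wassersteinBall nrm ξ δ := ⟨hf, hfW.trans (ENNReal.ofReal_le_ofReal hcost)⟩
  have hgood := h.trans (iInf₂_le f hball)
  have hS : MeasurableSet {x : Fin m → ℝ | L < totalPV x} :=
    measurableSet_lt measurable_const measurable_totalPV
  have hcompl : {x : Fin m → ℝ | L - totalPV x ≥ 0} = {x | L < totalPV x}ᶜ := by
    ext x
    simp
  rw [hcompl] at hgood
  have htot := add_le_add hfS hgood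
  rw [prob_add_prob_compl hS, hwmass, ← ENNReal.ofReal_add (by linarith [hkα.trans' (by positivity)]) (by linarith),
    ENNReal.ofReal_le_one] at htot
  linarith

/-! ### Equivalence with the mixed-integer system -/

theorem theorem1 {H m N : ℕ} (hm : 0 < m) (hN : 0 < N)
    -- an arbitrary norm on `ℝ^m`
    (nrm : Seminorm ℝ (Fin m → ℝ)) (hnrm : ∀ x, nrm x = 0 → x = 0)
    -- energy consumption of the HVAC units, PV samples, risk level, radius
    (P : Fin H → ℝ) (ξ : Fin N → Fin m → ℝ)
    (α δ : ℝ) (hα0 : 0 < α) (hα1 : α < 1) (hδ : 0 < δ)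
    -- a permutation that sorts the total PV samples in non-increasing order
    (σ : Equiv.Perm (Fin N)) (hσ : Antitone fun n => totalPV (ξ (σ n)))
    -- all units ON give more load than the smallest total PV sample
    (hload : ∑ l, P l > totalPV (ξ (σ ⟨N - 1, Nat.sub_lt hN one_pos⟩)))
    -- sufficiently large big-M constants, the same for all decisions
    (M M2 : Fin (riskIndex α N + 1) → ℝ)
    (hM : ∀ v : Fin H → ℝ, IsBinary v → ∀ n,
      load P v - totalPV (ξ (σ (Fin.castLE (riskIndex_succ_le hα1 hN) n))) ≤ M n)
    (hM2 : ∀ v : Fin H → ℝ, IsBinary v → ∀ n,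
      totalPV (ξ (σ (Fin.castLE (riskIndex_succ_le hα1 hN) n))) - load P v ≤ M2 n)
    (u : Fin H → ℝ) (hu : IsBinary u) :
    (DRChanceConstraint (wassersteinBall nrm ξ δ) (load P u) α ↔
      MILPFeasible (riskIndex_succ_le hα1 hN) α (δ * dualNormOnes nrm) (load P u)
        (fun n => totalPV (ξ (σ n))) M M2) ∧
    (dualNormOnes nrm = 1 →
      (DRChanceConstraint (wassersteinBall nrm ξ δ) (load P u) α ↔
        MILPFeasible (riskIndex_succ_le hα1 hN) α δ (load P u)
          (fun n => totalPV (ξ (σ n))) M M2)) := by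
  have hc := dualNormOnes_pos hm nrm hnrm
  have hN' : (0 : ℝ) < N := by exact_mod_cast hN
  have hkα : (riskIndex α N : ℝ) / N ≤ α :=
    (div_le_iff₀ hN').2 (Nat.floor_le (by positivity))
  have hαk : α < (riskIndex α N + 1 : ℝ) / N := (lt_div_iff₀ hN').2 (Nat.lt_floor_add_one _)
  have hmain : DRChanceConstraint (wassersteinBall nrm ξ δ) (load P u) α ↔
      MILPFeasible (riskIndex_succ_le hα1 hN) α (δ * dualNormOnes nrm) (load P u)
        (fun n => totalPV (ξ (σ n))) M M2 := by
    have hball : wassersteinBall nrm ξ δ = wassersteinBall nrm (fun n => ξ (σ n)) δ := by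
      simp only [wassersteinBall, empiricalDist_comp_perm]
    rw [milpFeasible_iff_le_greedyCost _ hkα (hM u hu) (hM2 u hu), hball]
    exact ⟨le_greedyCost_of_drChanceConstraint _ nrm hc _ hα1 hkα hαk hδ,
      drChanceConstraint_of_le_greedyCost _ nrm hc (totalPV_le_dualNormOnes_mul nrm hnrm) _ hσ
        hα0.le hδ⟩
  refine ⟨hmain, fun h1 => ?_⟩
  rw [hmain, h1, mul_one]
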